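/- For an infinite cardinal $\kappa$, Jensen's principle $\square_\kappa$ asserts that there is a sequence $\langle C_\alpha \mid \alpha<\kappa^+,\ \alpha \text{ a limit ordinal}\rangle$ such that, for every limit ordinal $\alpha<\kappa^+$: (i) $C_\alpha$ is a closed and unbounded subset of $\alpha$; (ii) the order type of $C_\alpha$ is at most $\kappa$; (iii) if $\beta<\alpha$ is a limit point of $C_\alpha$, then $C_\beta = C_\alpha\cap\beta$. For a positive integer $n$, an $n$-ladder is a lattice $L$ such that every principal ideal $\{y\in L\mid y\le x\}$ is finite and every element of $L$ has at most $n$ lower covers, where $y$ is a lower cover of $x$ if $y<x$ and there is no $z\in L$ with $y<z<x$. If $\square_{\aleph_1}$ holds, then there exists a $3$-ladder of cardinality $\aleph_2$. -/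

import Mathlib

open Cardinal Ordinal Order

universe u

/-- `C` is a `□_κ`-sequence: for every limit ordinal `α < κ⁺`,
* `C α` is a closed unbounded subset of `α`;
* the order type of `C α` is at most `κ`;
* if `β < α` is a limit point of `C α`, then `C β = C α ∩ β`.
An ordinal `α` is identified with the set `Set.Iio α` of its predecessors. Values of `C` outside the
limit ordinals below `κ⁺` are irrelevant. The order type of a set of ordinals of `Ordinal.{u}` lives
one universe higher, whence the `lift`. -/
structure IsSquareSequence (κ : Cardinal.{u}) (C : Ordinal.{u} → Set Ordinal.{u}) : Prop where
  subset : ∀ α < (succ κ).ord, IsSuccLimit α → C α ⊆ Set.Iio α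
  isClub : ∀ α < (succ κ).ord, IsSuccLimit α →
    IsClub {x : Set.Iio α | (x : Ordinal.{u}) ∈ C α}
  type_le : ∀ α < (succ κ).ord, IsSuccLimit α →
    typeLT (C α) ≤ Ordinal.lift.{u + 1, u} κ.ord
  coherent : ∀ α < (succ κ).ord, IsSuccLimit α →
    ∀ β < α, AccPt β (Filter.principal (C α)) → C β = C α ∩ Set.Iio β

/-- Jensen's square principle `□_κ`. -/
def SquarePrinciple (κ : Cardinal.{u}) : Prop :=
  ∃ C : Ordinal.{u} → Set Ordinal.{u}, IsSquareSequence κ C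

/-- An `n`-ladder: a lattice whose principal ideals are finite and whose elements have at most `n`
lower covers. -/
structure IsLadder (n : ℕ) (L : Type u) [Lattice L] : Prop where
  finite_Iic : ∀ x : L, (Set.Iic x).Finite
  lowerCovers_le : ∀ x : L, {y : L | y ⋖ x}.encard ≤ n

/-! ### Lattices with finite principal ideals -/

section LowerFinite

variable {K : Type u} [Lattice K]

/-! The ladder is built in two steps of one construction. From an infinite `n`-ladder `K` and a
well-order `W`, take the pairs `(a, k)` in `W × K`, with `(b, l) ≤ (a, k)` iff `b ≤ a`, `l ≤ k` and
`ρ b a ≤ k`, where `ρ : W → W → K` is subadditive with finite sublevel sets. Subadditivity gives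
transitivity and meets, finiteness gives finite ideals, and passing from `K` to the pairs adds at
most one lower cover (`Fibered.encard_lowerCovers_le`).

The function `ρ` comes from walking down cofinal sets `D a` (`exists_isSubadditive`): `ρ b a` joins
`ρ b η` with a label of `η`, the first point of `D a` at or above `b`. Labels along `D a` are
distinct, which is possible because its proper initial segments are smaller than `K`; and they
depend only on the segment, so coherence of `D` makes walks agree.

For `K = ℕ` and `W = ω₁`, finite initial segments suffice and a `2`-ladder of size `ℵ₁` results.
With that as `K` and `W = ω₂`, the sets `D a` come from the square sequence. -/

/-- In an infinite lattice with finite principal ideals, a set of smaller cardinality does not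
contain any principal filter. -/
theorem exists_ge_notMem_of_finite_Iic [Infinite K] (hK : ∀ x : K, (Set.Iic x).Finite)
    (x : K) (S : Set K) (hS : #S < #K) : ∃ y, x ≤ y ∧ y ∉ S := by
  by_contra! h
  -- Each `y` lies below `x ⊔ y ∈ S`, so `K` is a union of `#S` finite ideals.
  have hcov : (Set.univ : Set K) ⊆ ⋃ s ∈ S, Set.Iic s := fun y _ =>
    Set.mem_biUnion (h (x ⊔ y) le_sup_left) le_sup_right
  rcases S.finite_or_infinite with hf | hi
  · exact Set.infinite_univ ((hf.biUnion fun s _ => hK s).subset hcov)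
  · have : Infinite S := hi.to_subtype
    have h1 : #K ≤ #(⋃ s ∈ S, Set.Iic s : Set K) := by
      rw [← mk_univ]; exact mk_le_mk_of_subset hcov
    have h2 : #(⋃ s ∈ S, Set.Iic s : Set K) ≤ #S * ℵ₀ := by
      refine (mk_biUnion_le _ _).trans (mul_le_mul_right ?_ _)
      exact ciSup_le' fun s => (hK s).countable.le_aleph0
    rw [mul_aleph0_eq (aleph0_le_mk S)] at h2
    exact (h1.trans h2).not_gt hS

theorem exists_isBot_of_finite_Iic [Nonempty K] (hK : ∀ x : K, (Set.Iic x).Finite) :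
    ∃ b : K, IsBot b := by
  obtain ⟨x⟩ := ‹Nonempty K›
  obtain ⟨m, -, hm⟩ := (hK x).exists_le_minimal (a := x) (by simp)
  exact ⟨m, fun y => (hm.le_of_le (y := m ⊓ y) (inf_le_left.trans hm.prop) inf_le_left).trans
    inf_le_right⟩

end LowerFinite

/-! ### Joins from meets -/

section LatticeOfFinite

variable {P : Type u} [PartialOrder P]

/-- A minimal common upper bound is least: its meet with any other upper bound is again an upper
bound. -/
theorem exists_isLUB_of_finite_Iic (hfin : ∀ x : P, (Set.Iic x).Finite)
    (hinf : ∀ a b : P, ∃ c, IsGLB {a, b} c) (hdir : ∀ a b : P, ∃ c, a ≤ c ∧ b ≤ c) (a b : P) :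
    ∃ c, IsLUB {a, b} c := by
  obtain ⟨u, hau, hbu⟩ := hdir a b
  have hset : {x | x ≤ u ∧ a ≤ x ∧ b ≤ x}.Finite := (hfin u).subset fun x hx => hx.1
  obtain ⟨m, hmu, hm⟩ := hset.exists_le_minimal (a := u) ⟨le_rfl, hau, hbu⟩
  refine ⟨m, by simp [hm.prop.2.1, hm.prop.2.2], fun v hv => ?_⟩
  obtain ⟨c, hc⟩ := hinf m v
  have hcm : c ≤ m := hc.1 (by simp)
  refine (hm.le_of_le ⟨hcm.trans hmu, hc.2 ?_, hc.2 ?_⟩ hcm).trans (hc.1 (by simp))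
  · simp [hm.prop.2.1, hv (show a ∈ ({a, b} : Set P) by simp)]
  · simp [hm.prop.2.2, hv (show b ∈ ({a, b} : Set P) by simp)]

/-- A partial order with finite principal ideals, binary meets and binary upper bounds is a
lattice. -/
noncomputable abbrev latticeOfFiniteIic (hfin : ∀ x : P, (Set.Iic x).Finite)
    (hinf : ∀ a b : P, ∃ c, IsGLB {a, b} c) (hdir : ∀ a b : P, ∃ c, a ≤ c ∧ b ≤ c) :
    Lattice P where
  inf a b := (hinf a b).choose
  inf_le_left a b := (hinf a b).choose_spec.1 (by simp)
  inf_le_right a b := (hinf a b).choose_spec.1 (by simp)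
  le_inf a b c hab hac := (hinf b c).choose_spec.2 (by simp [hab, hac])
  sup a b := (exists_isLUB_of_finite_Iic hfin hinf hdir a b).choose
  le_sup_left a b := (exists_isLUB_of_finite_Iic hfin hinf hdir a b).choose_spec.1 (by simp)
  le_sup_right a b := (exists_isLUB_of_finite_Iic hfin hinf hdir a b).choose_spec.1 (by simp)
  sup_le a b c hac hbc :=
    (exists_isLUB_of_finite_Iic hfin hinf hdir a b).choose_spec.2 (by simp [hac, hbc])

end LatticeOfFinite

/-! ### Subadditive functions from coherent systems -/

section LadderSystem

variable {W : Type u} [LinearOrder W]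

/-- A system of cofinal sets `D w ⊆ Iio w` whose proper initial segments have cardinality less
than `c` and which is coherent at those proper initial segments without a greatest element. -/
structure IsCoherentSystem (c : Cardinal.{u}) (D : W → Set W) : Prop where
  lt : ∀ ⦃w v⦄, v ∈ D w → v < w
  cofinal : ∀ ⦃w v⦄, v < w → ∃ x ∈ D w, v ≤ x
  card_lt : ∀ ⦃w v⦄, v ∈ D w → #(D w ∩ Set.Iio v : Set W) < c
  coherent : ∀ ⦃w v⦄, v ∈ D w →
    D w ∩ Set.Iio v = ∅ ∨ (∃ x, IsGreatest (D w ∩ Set.Iio v) x) ∨ D v = D w ∩ Set.Iio v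

/-- A subadditive function on the pairs of a linear order, with values in a lattice, all of whose
sublevel sets are finite. -/
structure IsSubadditive {K : Type*} [Lattice K] [OrderBot K] (ρ : W → W → K) : Prop where
  self : ∀ a, ρ a a = ⊥
  le_sup_left : ∀ ⦃a b c⦄, a ≤ b → b ≤ c → ρ a c ≤ ρ a b ⊔ ρ b c
  le_sup_right : ∀ ⦃a b c⦄, a ≤ b → b ≤ c → ρ a b ≤ ρ a c ⊔ ρ b c
  finite : ∀ c k, {a | a ≤ c ∧ ρ a c ≤ k}.Finite

variable {K : Type u} [Lattice K] [OrderBot K]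

open Classical in
/-- A subadditive function can be made to vanish on pairs with least first entry. -/
theorem IsSubadditive.update_bot [OrderBot W] {ρ : W → W → K} (h : IsSubadditive ρ) :
    IsSubadditive fun a b => if a = ⊥ then ⊥ else ρ a b where
  self a := by simp [h.self]
  le_sup_left a b c hab hbc := by
    by_cases ha : a = ⊥
    · simp [ha]
    · have hb : b ≠ ⊥ := fun hb => ha (le_bot_iff.1 (hb ▸ hab))
      simpa [ha, hb] using h.le_sup_left hab hbc
  le_sup_right a b c hab hbc := by
    by_cases ha : a = ⊥
    · simp [ha]
    · have hb : b ≠ ⊥ := fun hb => ha (le_bot_iff.1 (hb ▸ hab))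
      simpa [ha, hb] using h.le_sup_right hab hbc
  finite c k := ((h.finite c k).union (Set.finite_singleton ⊥)).subset fun a ha => by
    by_cases h0 : a = ⊥
    · exact Or.inr h0
    · exact Or.inl ⟨ha.1, by simpa [h0] using ha.2⟩

variable [WellFoundedLT W]

/-- The least element of `D a` that is at least `b`. -/
noncomputable def nextIn (D : W → Set W) (a b : W) (h : ∃ x ∈ D a, b ≤ x) : W :=
  wellFounded_lt.min {x | x ∈ D a ∧ b ≤ x} h

open Classical in
/-- The recursive step in the construction of a subadditive function along a coherent system. -/
noncomputable def subadditiveStep (D : W → Set W) (pick : K → Set K → K) (a : W)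
    (F : W → (W → K) × (Set W → K)) : (W → K) × (Set W → K) :=
  let r : W → K := fun b =>
    if h : ∃ x ∈ D a, b ≤ x then
      (F (nextIn D a b h)).1 b ⊔ (F (nextIn D a b h)).2 (D a ∩ Set.Iio (nextIn D a b h)) else ⊥
  -- The label of `a` over `S` avoids the labels of the points of `S` and, if `S` has a greatest
  -- point, dominates that point's label and its `ρ`-value to `a`.
  (r, fun S => pick
    (if h : ∃ x, IsGreatest S x then (F h.choose).2 (S ∩ Set.Iio h.choose) ⊔ r h.choose else ⊥)
    {y | ∃ x ∈ S, (F x).2 (S ∩ Set.Iio x) = y})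

open Classical in
/-- The pair of the subadditive function and its auxiliary function. -/
noncomputable def subadditivePair (D : W → Set W) (pick : K → Set K → K) :
    W → (W → K) × (Set W → K) :=
  wellFounded_lt.fix fun a F =>
    subadditiveStep D pick a fun x => if h : x < a then F x h else (fun _ => ⊥, fun _ => ⊥)

open Classical in
theorem subadditivePair_eq (D : W → Set W) (pick : K → Set K → K) (a : W) :
    subadditivePair D pick a = subadditiveStep D pick a
      fun x => if x < a then subadditivePair D pick x else (fun _ => ⊥, fun _ => ⊥) := by
  rw [subadditivePair, WellFounded.fix_eq]
  congr

theorem nextIn_mem (D : W → Set W) (a b : W) (h : ∃ x ∈ D a, b ≤ x) : nextIn D a b h ∈ D a :=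
  (wellFounded_lt.min_mem {x | x ∈ D a ∧ b ≤ x} h).1

theorem le_nextIn (D : W → Set W) (a b : W) (h : ∃ x ∈ D a, b ≤ x) : b ≤ nextIn D a b h :=
  (wellFounded_lt.min_mem {x | x ∈ D a ∧ b ≤ x} h).2

theorem nextIn_le (D : W → Set W) (a b : W) (h : ∃ x ∈ D a, b ≤ x) {x : W} (hx : x ∈ D a)
    (hb : b ≤ x) : nextIn D a b h ≤ x :=
  not_lt.1 (wellFounded_lt.not_lt_min {x | x ∈ D a ∧ b ≤ x} (x := x) ⟨hx, hb⟩)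

/-- The two functions given by the recursion, with their recursive equations. -/
theorem exists_recursive_pair [Infinite K] (hK : ∀ x : K, (Set.Iic x).Finite) {D : W → Set W}
    (hD : IsCoherentSystem #K D) :
    ∃ (ρ : W → W → K) (κ : Set W → W → K),
      (∀ a b, ¬ b < a → ρ b a = ⊥) ∧
      (∀ a b (h : ∃ x ∈ D a, b ≤ x), ρ b a =
        ρ b (nextIn D a b h) ⊔ κ (D a ∩ Set.Iio (nextIn D a b h)) (nextIn D a b h)) ∧
      (∀ a, ∀ S ⊆ Set.Iio a, #S < #K → ∀ x ∈ S, κ (S ∩ Set.Iio x) x ≠ κ S a) ∧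
      (∀ a, ∀ S ⊆ Set.Iio a, #S < #K → ∀ x, IsGreatest S x →
        κ (S ∩ Set.Iio x) x ⊔ ρ x a ≤ κ S a) := by
  classical
  have hp : ∀ (x : K) (S : Set K), ∃ y, x ≤ y ∧ (#S < #K → y ∉ S) := fun x S => by
    by_cases hS : #S < #K
    · obtain ⟨y, h1, h2⟩ := exists_ge_notMem_of_finite_Iic hK x S hS
      exact ⟨y, h1, fun _ => h2⟩
    · exact ⟨x, le_rfl, fun h => absurd h hS⟩
  choose pick hle hnot using hp
  obtain ⟨F, hF⟩ : ∃ F : W → (W → K) × (Set W → K), ∀ a, F a = subadditiveStep D pick a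
      fun x => if x < a then F x else (fun _ => ⊥, fun _ => ⊥) :=
    ⟨_, subadditivePair_eq D pick⟩
  have hF1 : ∀ a b (h : ∃ x ∈ D a, b ≤ x), (F a).1 b = (F (nextIn D a b h)).1 b ⊔
      (F (nextIn D a b h)).2 (D a ∩ Set.Iio (nextIn D a b h)) := by
    intro a b h
    have := hD.lt (nextIn_mem D a b h)
    rw [hF a]
    simp only [subadditiveStep]
    rw [dif_pos h, if_pos this]
  have hF2 : ∀ a, ∀ S ⊆ Set.Iio a, (F a).2 S = pick
      (if h : ∃ x, IsGreatest S x then (F h.choose).2 (S ∩ Set.Iio h.choose) ⊔ (F a).1 h.choose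
        else ⊥) {y | ∃ x ∈ S, (F x).2 (S ∩ Set.Iio x) = y} := by
    intro a S hS
    have e : (F a).2 S = pick
        (if h : ∃ x, IsGreatest S x then
          (if h.choose < a then F h.choose else (fun _ => ⊥, fun _ => ⊥)).2
            (S ∩ Set.Iio h.choose) ⊔ (F a).1 h.choose else ⊥)
        {y | ∃ x ∈ S, (if x < a then F x else (fun _ => ⊥, fun _ => ⊥)).2
          (S ∩ Set.Iio x) = y} := by
      rw [hF a]; rfl
    rw [e]
    congr 1
    · refine dite_congr rfl (fun h => ?_) fun _ => rfl
      rw [if_pos (show h.choose < a from hS h.choose_spec.1)]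
    · ext y
      refine exists_congr fun x => and_congr_right fun hx => ?_
      rw [if_pos (show x < a from hS hx)]
  refine ⟨fun b a => (F a).1 b, fun S a => (F a).2 S, fun a b h => ?_, hF1,
    fun a S hS hc x hx heq => ?_, fun a S hS hc x hx => ?_⟩
  · have h' : ¬ ∃ x ∈ D a, b ≤ x := fun ⟨x, hx, hb⟩ => h (hb.trans_lt (hD.lt hx))
    dsimp only
    rw [hF a]
    simp only [subadditiveStep]
    rw [dif_neg h']
  · have h2 : (F x).2 (S ∩ Set.Iio x) = pick _ _ := heq.trans (hF2 a S hS)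
    exact hnot _ {y | ∃ x ∈ S, (F x).2 (S ∩ Set.Iio x) = y}
      ((mk_image_le (f := fun x => (F x).2 (S ∩ Set.Iio x)) (s := S)).trans_lt hc) ⟨x, hx, h2⟩
  · have h : ∃ x, IsGreatest S x := ⟨x, hx⟩
    have hxe : h.choose = x := h.choose_spec.unique hx
    dsimp only
    rw [hF2 a S hS, dif_pos h, hxe]
    exact hle _ _

theorem exists_isSubadditive [Infinite K] (hK : ∀ x : K, (Set.Iic x).Finite) {D : W → Set W}
    (hD : IsCoherentSystem #K D) : ∃ ρ : W → W → K, IsSubadditive ρ := by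
  obtain ⟨ρ, κ, hbot, hρ, hinj, hle⟩ := exists_recursive_pair hK hD
  have hself : ∀ a, ρ a a = ⊥ := fun a => hbot a a (lt_irrefl a)
  have hinter : ∀ ⦃a x y⦄, x ∈ D a → y < x →
      (D a ∩ Set.Iio x) ∩ Set.Iio y = D a ∩ Set.Iio y := fun a x y _ hyx => by
    rw [Set.inter_assoc, Set.Iio_inter_Iio, min_eq_right hyx.le]
  have hkmax : ∀ ⦃a x y⦄, x ∈ D a → IsGreatest (D a ∩ Set.Iio x) y →
      κ (D a ∩ Set.Iio y) y ⊔ ρ y x ≤ κ (D a ∩ Set.Iio x) x := fun a x y hx hy => by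
    have := hle x _ Set.inter_subset_right (hD.card_lt hx) y hy
    rwa [hinter hx hy.1.2] at this
  have hkne : ∀ ⦃a x y⦄, x ∈ D a → y ∈ D a → y < x →
      κ (D a ∩ Set.Iio y) y ≠ κ (D a ∩ Set.Iio x) x := fun a x y hx hy hyx => by
    have := hinj x _ Set.inter_subset_right (hD.card_lt hx) y ⟨hy, hyx⟩
    rwa [hinter hx hyx] at this
  have key : ∀ a, (∀ ⦃b c⦄, b ≤ c → c ≤ a → ρ b a ≤ ρ b c ⊔ ρ c a ∧ ρ b c ≤ ρ b a ⊔ ρ c a) := by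
    intro a
    induction a using WellFoundedLT.induction with
    | _ a ih =>
    intro b c hbc hca
    rcases hca.eq_or_lt with rfl | hca
    · simp [hself]
    have hb := hD.cofinal (hbc.trans_lt hca)
    have hc := hD.cofinal hca
    -- Up to the label of `x`, the values `ρ b a` and `ρ b x` agree for every `x ∈ D a` above `b`,
    -- not only for the first one.
    have hM : ∀ x ∈ D a, b ≤ x → ρ b a ≤ ρ b x ⊔ κ (D a ∩ Set.Iio x) x ∧
        ρ b x ≤ ρ b a ⊔ κ (D a ∩ Set.Iio x) x := by
      rw [hρ a b hb]
      intro x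
      induction x using WellFoundedLT.induction with
      | _ x ihx =>
      intro hx hbx
      rcases (nextIn_le D a b hb hx hbx).eq_or_lt with heq | hlt
      · rw [heq]; simp
      rcases hD.coherent hx with h0 | ⟨y, hy⟩ | hcoh
      · exact absurd (show _ ∈ D a ∩ Set.Iio x from ⟨nextIn_mem D a b hb, hlt⟩) (by simp [h0])
      -- At a point `x` with an immediate predecessor `y` in `D a`, the label of `x` absorbs both
      -- the label of `y` and `ρ y x`.
      · have hby : b ≤ y := (le_nextIn D a b hb).trans (hy.2 ⟨nextIn_mem D a b hb, hlt⟩)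
        obtain ⟨h1, h2⟩ := ihx y hy.1.2 hy.1.1 hby
        obtain ⟨h3, h4⟩ := ih x (hD.lt hx) hby hy.1.2.le
        have h5 := hkmax hx hy
        obtain ⟨h5, h6⟩ := sup_le_iff.1 h5
        constructor
        · refine h1.trans (sup_le (h4.trans (sup_le_sup_left h6 _)) (h5.trans le_sup_right))
        · refine h3.trans (sup_le (h2.trans (sup_le_sup_left h5 _)) (h6.trans le_sup_right))
      -- At a coherent point, the walks from `a` and from `x` to `b` take the same first step with
      -- the same label, so `ρ b x = ρ b a`.
      · have hb' : ∃ z ∈ D x, b ≤ z := by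
          rw [hcoh]; exact ⟨_, ⟨nextIn_mem D a b hb, hlt⟩, le_nextIn D a b hb⟩
        have he : nextIn D x b hb' = nextIn D a b hb := by
          apply le_antisymm
          · exact nextIn_le D x b hb' (hcoh ▸ ⟨nextIn_mem D a b hb, hlt⟩) (le_nextIn D a b hb)
          · have := nextIn_mem D x b hb'
            rw [hcoh] at this
            exact nextIn_le D a b hb this.1 (le_nextIn D x b hb')
        have : ρ b x = ρ b (nextIn D a b hb) ⊔
            κ (D a ∩ Set.Iio (nextIn D a b hb)) (nextIn D a b hb) := by
          rw [hρ x b hb', he, hcoh, hinter hx hlt]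
        rw [← this]
        exact ⟨le_sup_left, le_sup_left⟩
    -- Replace `a` by the first point of `D a` above `c`; the label this costs is already part of `ρ
    -- c a`.
    have hcη := le_nextIn D a c hc
    have hη := nextIn_mem D a c hc
    obtain ⟨h1, h2⟩ := hM _ hη (hbc.trans hcη)
    obtain ⟨h3, h4⟩ := ih _ (hD.lt hη) hbc hcη
    rw [hρ a c hc]
    constructor
    · refine h1.trans ?_
      rw [← sup_assoc]
      exact sup_le_sup_right h3 _
    · refine h4.trans ?_
      rw [sup_comm (ρ c _) (κ _ _), ← sup_assoc]
      exact sup_le_sup_right h2 _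
  refine ⟨ρ, hself, fun a b c hab hbc => (key c hab hbc).1,
    fun a b c hab hbc => (key c hab hbc).2, fun c k => ?_⟩
  induction c using WellFoundedLT.induction with
  | _ c ih =>
  -- Distinct labels in a finite ideal leave finitely many first steps of the walk.
  have hfin : {x | x ∈ D c ∧ κ (D c ∩ Set.Iio x) x ≤ k}.Finite := by
    refine Set.Finite.of_finite_image (f := fun x => κ (D c ∩ Set.Iio x) x)
      ((hK k).subset ?_) ?_
    · rintro _ ⟨x, hx, rfl⟩; exact hx.2
    · intro x hx y hy hxy
      by_contra hne
      rcases lt_or_gt_of_ne hne with h | h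
      · exact hkne hy.1 hx.1 h hxy
      · exact hkne hx.1 hy.1 h hxy.symm
  refine ((hfin.biUnion fun x hx => ih x (hD.lt hx.1)).union (Set.finite_singleton c)).subset ?_
  rintro a ⟨hac, hak⟩
  rcases hac.eq_or_lt with rfl | hac
  · exact Or.inr rfl
  have ha := hD.cofinal hac
  rw [hρ c a ha, sup_le_iff] at hak
  exact Or.inl (Set.mem_biUnion (x := nextIn D c a ha) ⟨nextIn_mem D c a ha, hak.2⟩
    ⟨le_nextIn D c a ha, hak.1⟩)

end LadderSystem

/-! ### The ladder on pairs -/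

section Fibered

variable {W K : Type u}

/-- The underlying type of the lattice given by a subadditive function `ρ`. -/
@[ext]
structure Fibered (ρ : W → W → K) where
  base : W
  height : K

namespace Fibered

theorem mk_eq_mul {ρ : W → W → K} : #(Fibered ρ) = #W * #K := by
  rw [mul_def]
  exact mk_congr ⟨fun x => (x.1, x.2), fun x => ⟨x.1, x.2⟩, fun _ => rfl, fun _ => rfl⟩

variable [LinearOrder W] [Lattice K] [OrderBot K] {ρ : W → W → K}

/-- The order on `Fibered ρ`: a pair `(b, l)` is below `(a, k)` if `b ≤ a`, `l ≤ k` and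
`ρ b a ≤ k`. -/
abbrev partialOrder (hρ : IsSubadditive ρ) : PartialOrder (Fibered ρ) where
  le x y := x.base ≤ y.base ∧ x.height ≤ y.height ∧ ρ x.base y.base ≤ y.height
  le_refl x := ⟨le_rfl, le_rfl, by simp [hρ.self]⟩
  le_trans x y z h h' := ⟨h.1.trans h'.1, h.2.1.trans h'.2.1,
    (hρ.le_sup_left h.1 h'.1).trans (sup_le (h.2.2.trans h'.2.1) h'.2.2)⟩
  le_antisymm _ _ h h' := Fibered.ext (h.1.antisymm h'.1) (h.2.1.antisymm h'.2.1)

theorem finite_Iic (hρ : IsSubadditive ρ) (hK : ∀ k : K, (Set.Iic k).Finite) (x : Fibered ρ) :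
    letI := partialOrder hρ
    (Set.Iic x).Finite := by
  let := partialOrder hρ
  refine (((hρ.finite x.base x.height).prod (hK x.height)).image
    fun p => (⟨p.1, p.2⟩ : Fibered ρ)).subset fun y hy => ?_
  exact ⟨(y.base, y.height), ⟨⟨hy.1, hy.2.2⟩, hy.2.1⟩, rfl⟩

/-- The base of the meet is the largest `c` lying in both sublevel sets; `hbot` guarantees that
there is one. -/
theorem exists_isGLB [OrderBot W] (hρ : IsSubadditive ρ) (hbot : ∀ a, ρ ⊥ a = ⊥)
    (x y : Fibered ρ) :
    letI := partialOrder hρ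
    ∃ z, IsGLB {x, y} z := by
  let := partialOrder hρ
  have hfin : {c | (c ≤ x.base ∧ ρ c x.base ≤ x.height) ∧
      c ≤ y.base ∧ ρ c y.base ≤ y.height}.Finite :=
    (hρ.finite x.base x.height).subset fun c hc => hc.1
  obtain ⟨c, ⟨⟨h1, h2⟩, h3, h4⟩, hc⟩ := Set.exists_max_image _ id hfin ⟨⊥, by simp [hbot]⟩
  refine ⟨⟨c, x.height ⊓ y.height⟩, ?_, fun d hd => ?_⟩
  · rintro z (rfl | rfl)
    · exact ⟨h1, inf_le_left, h2⟩
    · exact ⟨h3, inf_le_right, h4⟩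
  · have hx : d ≤ x := hd (by simp)
    have hy : d ≤ y := hd (by simp)
    have hdc : d.base ≤ c := hc d.base ⟨⟨hx.1, hx.2.2⟩, hy.1, hy.2.2⟩
    exact ⟨hdc, le_inf hx.2.1 hy.2.1, le_inf
      ((hρ.le_sup_right hdc h1).trans (sup_le hx.2.2 h2))
      ((hρ.le_sup_right hdc h3).trans (sup_le hy.2.2 h4))⟩

theorem exists_le_le (hρ : IsSubadditive ρ) (x y : Fibered ρ) :
    letI := partialOrder hρ
    ∃ z, x ≤ z ∧ y ≤ z := by
  let := partialOrder hρ
  wlog h : x.base ≤ y.base generalizing x y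
  · obtain ⟨z, hz⟩ := this y x (le_of_not_ge h)
    exact ⟨z, hz.symm⟩
  · exact ⟨⟨y.base, x.height ⊔ y.height ⊔ ρ x.base y.base⟩,
      ⟨h, le_sup_left.trans le_sup_left, le_sup_right⟩,
      ⟨le_rfl, le_sup_right.trans le_sup_left, by simp [hρ.self]⟩⟩

/-- A lower cover changes only one coordinate. Those that lower the base keep the height, and their
bases are comparable under the order on pairs, so there is at most one. -/
theorem encard_lowerCovers_le (hρ : IsSubadditive ρ) (x : Fibered ρ) :
    letI := partialOrder hρ
    {y | y ⋖ x}.encard ≤ {l | l ⋖ x.height}.encard + 1 := by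
  let := partialOrder hρ
  have hsub : {y | y ⋖ x} ⊆ (fun l => (⟨x.base, l⟩ : Fibered ρ)) '' {l | l ⋖ x.height} ∪
      {y | y ⋖ x ∧ y.base ≠ x.base} := by
    intro y hy
    by_cases hb : y.base = x.base
    · refine Or.inl ⟨y.height, ?_, Fibered.ext hb.symm rfl⟩
      refine ⟨lt_of_le_of_ne hy.le.2.1 fun h => hy.ne (Fibered.ext hb h), fun l h1 h2 => ?_⟩
      refine hy.2 (c := ⟨x.base, l⟩) (lt_of_le_of_ne ⟨hb.le, h1.le, ?_⟩ fun h => ?_)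
        (lt_of_le_of_ne ⟨le_rfl, h2.le, ?_⟩ fun h => ?_)
      · simp [hb, hρ.self]
      · exact h1.ne (congrArg Fibered.height h)
      · simp [hρ.self]
      · exact h2.ne (congrArg Fibered.height h)
    · exact Or.inr ⟨hy, hb⟩
  have hheight : ∀ y, y ⋖ x → y.base ≠ x.base → y.height = x.height := by
    intro y hy hb
    by_contra hne
    refine hy.2 (c := ⟨y.base, x.height⟩) (lt_of_le_of_ne ⟨le_rfl, hy.le.2.1, ?_⟩ fun h => ?_)
      (lt_of_le_of_ne ⟨hy.le.1, le_rfl, hy.le.2.2⟩ fun h => ?_)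
    · simp [hρ.self]
    · exact hne (Fibered.ext_iff.1 h).2
    · exact hb (Fibered.ext_iff.1 h).1
  have hnot : ∀ y z, y ⋖ x → z ⋖ x → y.base ≠ x.base → z.base ≠ x.base → ¬ y.base < z.base := by
    intro y z hy hz hyb hzb hlt
    refine hy.2 (c := z) (lt_of_le_of_ne ⟨hlt.le, ?_, ?_⟩ fun h => ?_) hz.lt
    · rw [hheight y hy hyb, hheight z hz hzb]
    · rw [hheight z hz hzb]
      exact (hρ.le_sup_right hlt.le hz.le.1).trans (sup_le hy.le.2.2 hz.le.2.2)
    · exact hlt.ne (congrArg Fibered.base h)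
  have hone : {y | y ⋖ x ∧ y.base ≠ x.base}.encard ≤ 1 := by
    rw [Set.encard_le_one_iff]
    rintro y z ⟨hy, hyb⟩ ⟨hz, hzb⟩
    exact Fibered.ext (le_antisymm (not_lt.1 (hnot z y hz hy hzb hyb))
      (not_lt.1 (hnot y z hy hz hyb hzb))) ((hheight y hy hyb).trans (hheight z hz hzb).symm)
  exact (Set.encard_le_encard hsub).trans ((Set.encard_union_le _ _).trans
    (add_le_add (Set.encard_image_le _ _) hone))

end Fibered

end Fibered

/-- An infinite `n`-ladder `K` and a coherent system on `W` whose proper initial segments are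
smaller than `K` give an `(n + 1)`-ladder on `W × K`. -/
theorem IsLadder.exists_succ {n : ℕ} {K : Type u} [Lattice K] [Infinite K] (hK : IsLadder n K)
    {W : Type u} [LinearOrder W] [WellFoundedLT W] [Nonempty W] {D : W → Set W}
    (hD : IsCoherentSystem #K D) :
    ∃ (L : Type u) (_ : Lattice L), IsLadder (n + 1) L ∧ #L = #W * #K := by
  obtain ⟨b, hb⟩ := exists_isBot_of_finite_Iic hK.finite_Iic
  let : OrderBot K := { bot := b, bot_le := hb }
  let : OrderBot W := WellFoundedLT.toOrderBot W
  obtain ⟨ρ, hρ⟩ := exists_isSubadditive hK.finite_Iic hD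
  let := Fibered.partialOrder hρ.update_bot
  have hfin := Fibered.finite_Iic hρ.update_bot hK.finite_Iic
  refine ⟨_, latticeOfFiniteIic hfin (Fibered.exists_isGLB hρ.update_bot fun a => if_pos rfl)
    (Fibered.exists_le_le hρ.update_bot), @IsLadder.mk _ _ (_) hfin fun x => ?_,
    Fibered.mk_eq_mul⟩
  refine (Fibered.encard_lowerCovers_le hρ.update_bot x).trans ?_
  rw [Nat.cast_add, Nat.cast_one]
  exact add_le_add_left (hK.lowerCovers_le _) 1

/-! ### Coherent systems on `ω₁` and from square -/

/-- If all proper initial segments of `W` are countable, then there is a system of cofinal sets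
whose proper initial segments are finite. -/
theorem exists_isCoherentSystem_aleph0 {W : Type u} [LinearOrder W]
    (hW : ∀ w : W, (Set.Iio w).Countable) : ∃ D : W → Set W, IsCoherentSystem ℵ₀ D := by
  have key : ∀ w : W, ∃ S ⊆ Set.Iio w, (∀ v < w, ∃ x ∈ S, v ≤ x) ∧
      ∀ v ∈ S, (S ∩ Set.Iio v).Finite := by
    intro w
    rcases (Set.Iio w).eq_empty_or_nonempty with h0 | hne
    · exact ⟨∅, by simp, fun v hv => absurd (show v ∈ Set.Iio w from hv) (by simp [h0]), by simp⟩
    obtain ⟨f, hf⟩ := (hW w).exists_eq_range hne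
    -- Take the record values of an enumeration: smaller records occur earlier, so only finitely
    -- many precede a given one.
    refine ⟨{x | ∃ n, f n = x ∧ ∀ m < n, f m < f n}, ?_, fun v hv => ?_, ?_⟩
    · rintro _ ⟨n, rfl, -⟩
      exact hf ▸ Set.mem_range_self n
    · have hex : ∃ n, v ≤ f n := by
        obtain ⟨n, hn⟩ : v ∈ Set.range f := hf ▸ hv
        exact ⟨n, hn.ge⟩
      classical
      refine ⟨f (Nat.find hex), ⟨_, rfl, fun m hm => ?_⟩, Nat.find_spec hex⟩
      exact (not_le.1 (Nat.find_min hex hm)).trans_le (Nat.find_spec hex)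
    · rintro _ ⟨n, rfl, hn⟩
      refine ((Set.finite_Iio n).image f).subset ?_
      rintro _ ⟨⟨m, rfl, hm⟩, hlt⟩
      refine ⟨m, ?_, rfl⟩
      change m < n
      by_contra hmn
      rcases (not_lt.1 hmn).eq_or_lt with rfl | h
      · exact lt_irrefl _ hlt
      · exact lt_asymm hlt (hm n h)
  choose D hlt hcof hfin using key
  refine ⟨D, fun w v hv => hlt w hv, fun w v hv => hcof w v hv,
    fun w v hv => lt_aleph0_iff_set_finite.2 (hfin w v hv), fun w v hv => ?_⟩
  rcases (D w ∩ Set.Iio v).eq_empty_or_nonempty with h0 | hne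
  · exact Or.inl h0
  · obtain ⟨x, hx, hmax⟩ := Set.exists_max_image _ id (hfin w v hv) hne
    exact Or.inr (Or.inl ⟨x, hx, hmax⟩)

/-- In a well-order, a point `v` of a club set `s` either has no predecessor in `s`, or a greatest
one, or is the supremum of its predecessors in `s`. -/
theorem IsClub.trichotomy {W : Type*} [LinearOrder W] [WellFoundedLT W] {s : Set W}
    (hs : IsClub s) (v : W) :
    s ∩ Set.Iio v = ∅ ∨ (∃ x, IsGreatest (s ∩ Set.Iio v) x) ∨ IsLUB (s ∩ Set.Iio v) v := by
  rcases (s ∩ Set.Iio v).eq_empty_or_nonempty with h0 | hne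
  · exact Or.inl h0
  have hub : v ∈ upperBounds (s ∩ Set.Iio v) := fun x hx => hx.2.le
  obtain ⟨m, hm, hmin⟩ : ∃ m ∈ upperBounds (s ∩ Set.Iio v),
      ∀ x ∈ upperBounds (s ∩ Set.Iio v), m ≤ x :=
    ⟨wellFounded_lt.min _ ⟨v, hub⟩, wellFounded_lt.min_mem _ _,
      fun x hx => not_lt.1 (wellFounded_lt.not_lt_min _ hx)⟩
  rcases (hmin v hub).eq_or_lt with rfl | hlt
  · exact Or.inr (Or.inr ⟨hm, hmin⟩)
  · exact Or.inr (Or.inl ⟨m, ⟨hs.isLUB_mem Set.inter_subset_left hne ⟨hm, hmin⟩, hlt⟩, hm⟩)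

theorem IsSquareSequence.mk_inter_Iio_lt {κ : Cardinal.{u}} {C : Ordinal.{u} → Set Ordinal.{u}}
    (hC : IsSquareSequence κ C) {α β : Ordinal.{u}} (hα : α < (succ κ).ord) (hlim : IsSuccLimit α)
    (hβ : β ∈ C α) : #(C α ∩ Set.Iio β : Set Ordinal.{u}) < Cardinal.lift.{u + 1} κ := by
  have h : typein (α := C α) (· < ·) ⟨β, hβ⟩ < (Cardinal.lift.{u + 1} κ).ord := by
    rw [← lift_ord]
    exact (typein_lt_type _ _).trans_le (hC.type_le α hα hlim)
  rw [lt_ord, card_typein] at h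
  refine lt_of_le_of_lt ?_ h
  exact mk_le_of_injective (f := fun x => ⟨⟨x.1, x.2.1⟩, x.2.2⟩) fun x y hxy => by
    simpa [Subtype.ext_iff] using hxy

/-- If `β` is the supremum of a nonempty `C α ∩ Set.Iio β`, it is a limit point of `C α`, and square
coherence applies. -/
theorem IsSquareSequence.trichotomy {κ : Cardinal.{u}} {C : Ordinal.{u} → Set Ordinal.{u}}
    (hC : IsSquareSequence κ C) {α β : Ordinal.{u}} (hα : α < (succ κ).ord) (hlim : IsSuccLimit α)
    (hβ : β < α) : C α ∩ Set.Iio β = ∅ ∨ (∃ x, IsGreatest (C α ∩ Set.Iio β) x) ∨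
      IsSuccLimit β ∧ C β = C α ∩ Set.Iio β := by
  rcases (hC.isClub α hα hlim).trichotomy ⟨β, hβ⟩ with h | ⟨x, hx, hmax⟩ | h
  · left
    ext x
    simp only [Set.mem_inter_iff, Set.mem_Iio, Set.mem_empty_iff_false, iff_false, not_and]
    intro hx hlt
    have : (⟨x, hlt.trans hβ⟩ : Set.Iio α) ∈ (∅ : Set (Set.Iio α)) := h ▸ ⟨hx, hlt⟩
    exact this
  · exact Or.inr (Or.inl ⟨x, hx, fun y hy => hmax (a := ⟨y, hy.2.trans hβ⟩) hy⟩)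
  · by_cases h0 : C α ∩ Set.Iio β = ∅
    · exact Or.inl h0
    right; right
    obtain ⟨z, hz⟩ := Set.nonempty_iff_ne_empty.2 h0
    have hacc : AccPt β (Filter.principal (C α)) := by
      rw [SuccOrder.accPt_principal]
      refine ⟨fun hmin => hmin.not_lt hz.2, fun b hb => ?_⟩
      obtain ⟨x, hx, hbx⟩ := (lt_isLUB_iff h).1
        (show (⟨b, hb.trans hβ⟩ : Set.Iio α) < ⟨β, hβ⟩ from hb)
      exact ⟨x, hx.1, hbx, hx.2⟩
    exact ⟨hacc.isSuccLimit, hC.coherent α hα hlim β hβ hacc⟩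

/-- A square sequence on `κ⁺` gives a coherent system, after adding the singletons of the
predecessors at the successor ordinals. -/
theorem SquarePrinciple.exists_isCoherentSystem {κ : Cardinal.{u}} (hκ : κ ≠ 0)
    (h : SquarePrinciple κ) :
    ∃ D : (succ κ).ord.ToType → Set (succ κ).ord.ToType, IsCoherentSystem κ D := by
  classical
  obtain ⟨C, hC⟩ := h
  let o : (succ κ).ord.ToType → Ordinal.{u} := fun w => (ToType.mk.symm w : Set.Iio _)
  have ho : ∀ w, o w < (succ κ).ord := fun w => (ToType.mk.symm w).2
  have holt : ∀ {v w}, o v < o w ↔ v < w := fun {v w} => by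
    simp only [o, Subtype.coe_lt_coe, OrderIso.lt_iff_lt]
  have hole : ∀ {v w}, o v ≤ o w ↔ v ≤ w := fun {v w} => by
    simp only [o, Subtype.coe_le_coe, OrderIso.le_iff_le]
  have hosurj : ∀ {a w}, a < o w → ∃ v, o v = a := fun {a w} ha =>
    ⟨ToType.mk ⟨a, ha.trans (ho w)⟩, by simp [o]⟩
  have hoinj : Function.Injective o := fun v w hvw => le_antisymm (hole.1 hvw.le) (hole.1 hvw.ge)
  -- Off the limits this is a singleton at successors and empty at `0`, so coherence there is
  -- vacuous.
  let E : Ordinal.{u} → Set Ordinal.{u} := fun a => if IsSuccLimit a then C a else {b | succ b = a}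
  have hElim : ∀ {a}, IsSuccLimit a → E a = C a := fun ha => if_pos ha
  have hEsucc : ∀ {a}, ¬ IsSuccLimit a → E a = {b | succ b = a} := fun ha => if_neg ha
  have hElt : ∀ {a b}, a < (succ κ).ord → b ∈ E a → b < a := fun {a b} ha hb => by
    by_cases hlim : IsSuccLimit a
    · rw [hElim hlim] at hb; exact hC.subset a ha hlim hb
    · rw [hEsucc hlim] at hb; exact hb ▸ lt_succ b
  have hEempty : ∀ {a b}, ¬ IsSuccLimit a → b ∈ E a → E a ∩ Set.Iio b = ∅ := fun {a b} ha hb => by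
    rw [hEsucc ha] at hb ⊢
    ext c
    simp only [Set.mem_inter_iff, Set.mem_ofPred_eq, Set.mem_Iio, Set.mem_empty_iff_false,
      iff_false, not_and]
    intro hc hcb
    exact hcb.ne (succ_injective (hc.trans hb.symm))
  have hpre : ∀ w v, o ⁻¹' E (o w) ∩ Set.Iio v = o ⁻¹' (E (o w) ∩ Set.Iio (o v)) := fun w v => by
    ext x; simp [holt]
  refine ⟨fun w => o ⁻¹' E (o w), fun w v hv => holt.1 (hElt (ho w) hv), fun w v hv => ?_,
    fun w v hv => ?_, fun w v hv => ?_⟩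
  · obtain ⟨b, hb, hvb⟩ : ∃ b ∈ E (o w), o v ≤ b := by
      rcases zero_or_succ_or_isSuccLimit (o w) with h0 | ⟨b, hb⟩ | hlim
      · exact absurd (holt.2 hv) (by simp [h0])
      · refine ⟨b, ?_, ?_⟩
        · rw [hEsucc (hb ▸ not_isSuccLimit_succ b)]; exact hb
        · exact lt_succ_iff.1 (hb.symm ▸ holt.2 hv)
      · obtain ⟨b, hb, hvb⟩ := (hC.isClub _ (ho w) hlim).isCofinal ⟨o v, holt.2 hv⟩
        exact ⟨b, (hElim hlim).symm ▸ hb, hvb⟩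
    obtain ⟨x, rfl⟩ := hosurj (hElt (ho w) hb)
    exact ⟨x, hb, hole.1 hvb⟩
  · by_cases hlim : IsSuccLimit (o w)
    · rw [hpre, hElim hlim, ← Cardinal.lift_lt.{u, u + 1}]
      have hv' : o v ∈ C (o w) := by rw [← hElim hlim]; exact hv
      refine lt_of_le_of_lt ?_ (hC.mk_inter_Iio_lt (ho w) hlim hv')
      rw [← Cardinal.lift_id'.{u, u + 1} #(C (o w) ∩ Set.Iio (o v) : Set Ordinal.{u})]
      exact mk_preimage_of_injective_lift _ _ hoinj
    · rw [hpre, hEempty hlim hv]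
      simpa using pos_iff_ne_zero.2 hκ
  · by_cases hlim : IsSuccLimit (o w)
    · simp only [hpre]
      rw [hElim hlim]
      rcases hC.trichotomy (ho w) hlim (hElt (ho w) hv) with h | ⟨x, hx⟩ | ⟨hlim', h⟩
      · left; rw [h, Set.preimage_empty]
      · right; left
        obtain ⟨y, rfl⟩ := hosurj hx.1.2
        exact ⟨y, hx.1, fun z hz => hole.1 (hx.2 hz)⟩
      · right; right
        rw [hElim hlim', h]
    · left; rw [hpre, hEempty hlim hv, Set.preimage_empty]

/-! ### The ladders of size `ℵ₁` and `ℵ₂` -/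

theorem isLadder_one_nat : IsLadder 1 (ULift.{u} ℕ) where
  finite_Iic x := ((Set.finite_Iic x.down).image ULift.up).subset fun y hy => ⟨y.down, hy, rfl⟩
  lowerCovers_le x := by
    rw [Nat.cast_one, Set.encard_le_one_iff]
    exact fun y z hy hz => hy.unique_left hz

theorem exists_isLadder_two_aleph_one :
    ∃ (L : Type u) (_ : Lattice L), IsLadder 2 L ∧ #L = ℵ_ 1 := by
  have hW : ∀ w : (ℵ_ 1 : Cardinal.{u}).ord.ToType, (Set.Iio w).Countable := fun w => by
    rw [← le_aleph0_iff_set_countable, ← lt_succ_iff, succ_aleph0]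
    exact (mk_Iio_lt w (by simp)).trans_eq (mk_ord_toType _)
  have hcard : #(ULift.{u} ℕ) = ℵ₀ := by simp
  have : Nonempty (ℵ_ 1 : Cardinal.{u}).ord.ToType := by
    rw [← mk_ne_zero_iff, mk_ord_toType]; exact (aleph_pos 1).ne'
  obtain ⟨D, hD⟩ := exists_isCoherentSystem_aleph0 hW
  obtain ⟨L, i, hL, hLc⟩ := isLadder_one_nat.exists_succ (hcard.symm ▸ hD)
  refine ⟨L, i, hL, ?_⟩
  rw [hLc, mk_ord_toType, hcard, mul_aleph0_eq (aleph0_le_aleph 1)]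

theorem mainTheorem5 (h : SquarePrinciple.{u} (ℵ_ 1)) :
    ∃ (L : Type u) (_ : Lattice L), IsLadder 3 L ∧ #L = ℵ_ 2 := by
  obtain ⟨K, _, hK, hKc⟩ := exists_isLadder_two_aleph_one.{u}
  have hsucc : succ (ℵ_ 1 : Cardinal.{u}) = ℵ_ 2 := by rw [succ_aleph, one_add_one_eq_two]
  obtain ⟨D, hD⟩ := h.exists_isCoherentSystem (aleph_pos 1).ne'
  have : Infinite K := by rw [infinite_iff, hKc]; exact aleph0_le_aleph 1
  have : Nonempty (succ (ℵ_ 1 : Cardinal.{u})).ord.ToType := by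
    rw [← mk_ne_zero_iff, mk_ord_toType]; exact (Cardinal.succ_pos _).ne'
  have hD' : IsCoherentSystem #K D := by rwa [hKc]
  obtain ⟨L, i, hL, hLc⟩ := hK.exists_succ hD'
  refine ⟨L, i, hL, ?_⟩
  rw [hLc, mk_ord_toType, hKc, hsucc,
    mul_eq_left (aleph0_le_aleph 2) (aleph_le_aleph.2 one_le_two) (aleph_pos 1).ne']
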